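/- Let $T$ be a commutative Noetherian ring, $f\in T$ a nonzerodivisor, $R=T/(f)$, and let $I$ be an ideal of $T$ containing $f$. Fix a finite sequence of generators $\mathbf v=(f,f_1,\dots,f_n)$ of $I$ ($n\ge 0$). A finitely generated $R$-module $L$ is called liftable to $T$ if there is a finitely generated $T$-module $M'$ with $M'\otimes_T R\cong L$ and $\operatorname{Tor}_i^T(M',R)=0$ for all $i>0$; an $R$-module is weakly liftable to $T$ if it is a direct summand of a liftable $R$-module. A linear map splits if it has a linear left inverse. The following are equivalent: (1) $T/I$, as an $R$-module, is weakly liftable to $T$. (2) The $T$-linear map $h:T/I\to I/fI$, $1+I\mapsto f+fI$, splits. (3) The $T$-linear map $g:T/I\to I/I^2$, $1+I\mapsto f+I^2$, splits. (4) For every presentation $T^m\xrightarrow{X}T^{n+1}\xrightarrow{\mathbf v}I\to 0$, with $\mathbf r,\mathbf r_1,\dots,\mathbf r_n$ the rows of $X$, there exist $x_1,\dots,x_n\in T$ such that $\mathbf r-(x_1\mathbf r_1+\dots+x_n\mathbf r_n)\in I\,T^m$. (4′) For some such presentation, there exist $x_1,\dots,x_n\in T$ as in (4). They imply the following condition (5);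 moreover (5) and (6) are equivalent, and if $T$ is local then (5), (6) and (7) are equivalent: (5) $(IJ:f)\subseteq J+I$ for every ideal $J$ of $T$. (6) $(IJ:f)\subseteq J$ for every ideal $J\supseteq I$ of $T$. (7) $(IJ:f)\subseteq J$ for every irreducible ideal $J\supseteq I$ of $T$ (an ideal is irreducible if it is proper and is not the intersection of two strictly larger ideals). If in addition $T/I$ is approximately Gorenstein, then all the conditions (1)–(6), and also (7) if $T$ is local, are equivalent. Here a Noetherian local ring is Gorenstein if it has finite injective dimension as a module over itself; a Noetherian local ring $(A,\mathfrak m)$ is approximately Gorenstein if for every integer $N\ge 0$ there is an ideal $Q\subseteq\mathfrak m^N$ such that $A/Q$ is a Gorenstein local ring; and a Noetherian ring is approximately Gorenstein if its localization at every maximal ideal is. -/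

import Mathlib

open scoped TensorProduct

universe u

namespace WeakLifting

/-- An `R`-module `M` lifts to `T` along `T → R` if there is a finitely generated `T`-module `M'`
with `R ⊗_T M' ≅ M` as `R`-modules and `Tor_i^T(M', R) = 0` for all `i > 0`. -/
def Liftable (T R : Type u) [CommRing T] [CommRing R] [Algebra T R]
    (M : Type u) [AddCommGroup M] [Module R M] : Prop :=
  ∃ (M' : Type u) (_ : AddCommGroup M') (_ : Module T M'),
    Module.Finite T M' ∧
    Nonempty (R ⊗[T] M' ≃ₗ[R] M) ∧
    ∀ i : ℕ, 0 < i → CategoryTheory.Limits.IsZero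
      (((CategoryTheory.Tor (ModuleCat.{u} T) i).obj (ModuleCat.of T M')).obj (ModuleCat.of T R))

/-- An `R`-module `M` weakly lifts to `T` if it is a direct summand of a liftable `R`-module. -/
def WeaklyLiftable (T R : Type u) [CommRing T] [CommRing R] [Algebra T R]
    (M : Type u) [AddCommGroup M] [Module R M] : Prop :=
  ∃ (L : Type u) (_ : AddCommGroup L) (_ : Module R L)
    (N : Type u) (_ : AddCommGroup N) (_ : Module R N),
    Liftable T R L ∧ Nonempty (L ≃ₗ[R] M × N)

/-- For `f ∈ I`, the ring map `T/(f) → T/I`. -/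
def quotMap {T : Type u} [CommRing T] {I : Ideal T} {f : T} (hf : f ∈ I) :
    T ⧸ Ideal.span {f} →+* T ⧸ I :=
  Ideal.Quotient.factor ((Ideal.span_singleton_le_iff_mem I).mpr hf)

/-- For `f ∈ I`, the statement that `T/I`, as a module over `R = T/(f)`, weakly lifts to `T`. -/
def QuotientWeaklyLiftable {T : Type u} [CommRing T] (I : Ideal T) (f : T) (hf : f ∈ I) : Prop :=
  letI : Module (T ⧸ Ideal.span {f}) (T ⧸ I) := Module.compHom (T ⧸ I) (quotMap hf)
  WeaklyLiftable T (T ⧸ Ideal.span {f}) (T ⧸ I)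

/-- The `T`-linear map `T/I → I/fI` with `1 + I ↦ f + fI`. -/
def mapToModF {T : Type u} [CommRing T] (I : Ideal T) (f : T) (hf : f ∈ I) :
    (T ⧸ I) →ₗ[T] (I ⧸ (Ideal.span {f} • ⊤ : Submodule T I)) :=
  Submodule.liftQ I
    (LinearMap.toSpanSingleton T (I ⧸ (Ideal.span {f} • ⊤ : Submodule T I))
      (Submodule.Quotient.mk ⟨f, hf⟩))
    (by
      intro a ha
      rw [LinearMap.mem_ker, LinearMap.toSpanSingleton_apply, ← Submodule.Quotient.mk_smul,
        Submodule.Quotient.mk_eq_zero]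
      have h : a • (⟨f, hf⟩ : I) = f • (⟨a, ha⟩ : I) := by
        ext; simp [mul_comm]
      rw [h]
      exact Submodule.smul_mem_smul (Ideal.mem_span_singleton_self f) trivial)

/-- The `T`-linear map `T/I → I/I²` with `1 + I ↦ f + I²`. -/
def mapToCotangent {T : Type u} [CommRing T] (I : Ideal T) (f : T) (hf : f ∈ I) :
    (T ⧸ I) →ₗ[T] I.Cotangent :=
  Submodule.liftQ I (LinearMap.toSpanSingleton T I.Cotangent (I.toCotangent ⟨f, hf⟩))
    (by
      intro a ha
      rw [LinearMap.mem_ker, LinearMap.toSpanSingleton_apply, ← map_smul, Ideal.toCotangent_eq_zero]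
      have h : ((a • (⟨f, hf⟩ : I) : I) : T) = a * f := rfl
      rw [h, pow_two]
      exact Ideal.mul_mem_mul ha hf)

/-- A `T`-linear map `A → B` splits if it has a `T`-linear left inverse. -/
def Splits {T A B : Type*} [CommRing T] [AddCommGroup A] [Module T A] [AddCommGroup B] [Module T B]
    (h : A →ₗ[T] B) : Prop :=
  ∃ s : B →ₗ[T] A, s ∘ₗ h = LinearMap.id

/-- `T^m --X--> T^k --v--> (v) → 0` is exact: the columns of `X` generate all relations
on the entries of `v`. -/
def IsPresentation {T : Type*} [CommRing T] {k m : ℕ} (v : Fin k → T)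
    (X : Matrix (Fin k) (Fin m) T) : Prop :=
  Function.Exact X.mulVecLin (Fintype.linearCombination T v)

/-- The zeroth row of `X` is, modulo `I T^m`, a `T`-linear combination of the other rows. -/
def RowCondition {T : Type*} [CommRing T] (I : Ideal T) {n m : ℕ}
    (X : Matrix (Fin (n + 1)) (Fin m) T) : Prop :=
  ∃ x : Fin n → T, X 0 - ∑ i : Fin n, x i • X i.succ ∈ (I • ⊤ : Submodule T (Fin m → T))

/-- A Noetherian local ring is Gorenstein if it has finite injective dimension over itself. -/
def IsGorensteinLocal (S : Type u) [CommRing S] : Prop :=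
  IsNoetherianRing S ∧ IsLocalRing S ∧
    ∃ n : ℕ, CategoryTheory.HasInjectiveDimensionLE (ModuleCat.of S S) n

/-- A local ring `(A, m)` is approximately Gorenstein if every power of `m` contains an ideal `Q`
such that `A/Q` is Gorenstein. -/
def IsApproxGorensteinLocal (A : Type u) [CommRing A] [IsLocalRing A] : Prop :=
  ∀ N : ℕ, ∃ Q : Ideal A, Q ≤ IsLocalRing.maximalIdeal A ^ N ∧ IsGorensteinLocal (A ⧸ Q)

/-- A Noetherian ring is approximately Gorenstein if all its localizations at maximal ideals are. -/
def IsApproxGorenstein (A : Type u) [CommRing A] : Prop :=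
  IsNoetherianRing A ∧
    ∀ (p : Ideal A) [p.IsMaximal], IsApproxGorensteinLocal (Localization.AtPrime p)

end WeakLifting

/-!
Conditions (1)–(4) all say that there is a `T`-linear map `φ : I → T/I` with `φ f = 1`. Since `f` is
a nonzerodivisor, vanishing of `Tor` against `T/(f)` means that `f` is regular on the module. So
such a `φ` makes `T/I` a summand of `I/fI`, which lifts to `I`. Conversely, if `T/I` is a summand of
`M/fM` and `m ∈ M` lifts its generator, then `I m ⊆ f M`, and `φ i` is the image of `f⁻¹ (i m)`.
In terms of a presentation of `I`, `φ` is a choice of values of the generators that is killed by the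
columns of the matrix.

Condition (5) follows by applying `φ` to `a f ∈ I J`. For the converse, (4) asks that the first row
modulo `I` lie in the span of the others. Over a Noetherian local ring this may be tested modulo
arbitrarily high powers of the maximal ideal, hence, when `T/I` is approximately Gorenstein, over
self-injective quotients `B` of its localizations: the quotient of a Gorenstein local ring by a
maximal regular sequence inside a power of the maximal ideal is self-injective. Over `B` a vector
lies in the span of given vectors as soon as it is orthogonal to every vector orthogonal to them,
and (6) for the kernel of `T → B` provides precisely this.
-/

namespace WeakLifting

section ShortResolution

open CategoryTheory Limits HomologicalComplex ZeroObject

universe v w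

variable {C : Type w} [Category.{v} C] [Abelian C] {A B : C}

/-- The chain complex `⋯ ⟶ 0 ⟶ A ⟶ B` with `φ : A ⟶ B` from degree `1` to degree `0`, the shape of a
resolution of length one. -/
noncomputable def twoTermComplex (φ : A ⟶ B) : ChainComplex C ℕ :=
  ChainComplex.of (fun | 0 => B | 1 => A | _ + 2 => 0) (fun | 0 => φ | _ + 1 => 0)
    fun _ => zero_comp

lemma twoTermComplex_d (φ : A ⟶ B) : (twoTermComplex φ).d 1 0 = φ := by
  simp [twoTermComplex, ChainComplex.of.d]

lemma isZero_twoTermComplex_X (φ : A ⟶ B) (n : ℕ) : IsZero ((twoTermComplex φ).X (n + 2)) :=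
  Limits.isZero_zero C

lemma forall_exactAt_succ_iff_mono (K : ChainComplex C ℕ) (hK : ∀ n, IsZero (K.X (n + 2))) :
    (∀ n, K.ExactAt (n + 1)) ↔ Mono (K.d 1 0) := by
  have exactAt_one_iff : K.ExactAt 1 ↔ Mono (K.d 1 0) := by
    rw [exactAt_iff' K 2 1 0 (by simp) (by simp)]
    exact ShortComplex.exact_iff_mono _ ((hK 0).eq_of_src _ _)
  refine ⟨fun h => exactAt_one_iff.1 (h 0), fun h n => ?_⟩
  cases n with
  | zero => exact exactAt_one_iff.2 h
  | succ n => exact ShortComplex.exact_of_isZero_X₂ _ (hK n)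

/-- A short exact sequence with projective first and second terms, as a projective resolution of
its third term, from which derived functors of that term are computed. -/
noncomputable def shortProjectiveResolution {S : ShortComplex C} (hS : S.ShortExact)
    [Projective S.X₁] [Projective S.X₂] : ProjectiveResolution S.X₃ where
  complex := twoTermComplex S.f
  projective
    | 0 => inferInstanceAs (Projective S.X₂)
    | 1 => inferInstanceAs (Projective S.X₁)
    | _ + 2 => inferInstanceAs (Projective (0 : C))
  π := (ChainComplex.toSingle₀Equiv _ _).symm ⟨S.g, by rw [twoTermComplex_d]; exact S.zero⟩
  quasiIso := ⟨fun n => by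
    have := hS.mono_f
    have := hS.epi_g
    cases n with
    | zero =>
      rw [ChainComplex.quasiIsoAt₀_iff, ShortComplex.quasiIso_iff_of_zeros']
      · refine (ShortComplex.exact_and_epi_g_iff_of_iso (S₂ := S) ?_).2 ⟨hS.exact, hS.epi_g⟩
        refine ShortComplex.isoMk (Iso.refl _) (Iso.refl _) (Iso.refl _) ?_ ?_
        · exact (Category.id_comp _).trans
            ((twoTermComplex_d S.f).symm.trans (Category.comp_id _).symm)
        · refine (Category.id_comp _).trans (Eq.trans ?_ (Category.comp_id _).symm)
          exact (ChainComplex.toSingle₀Equiv_symm_apply_f_zero (C := twoTermComplex S.f) S.g _).symm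
      · exact (twoTermComplex S.f).shape 0 0 (by simp)
      all_goals rfl
    | succ n =>
      rw [quasiIsoAt_iff_exactAt' _ _ (ChainComplex.exactAt_succ_single_obj _ _)]
      refine (forall_exactAt_succ_iff_mono _ (isZero_twoTermComplex_X S.f)).2 ?_ n
      rwa [twoTermComplex_d]⟩

lemma isZero_leftDerived_iff_mono {D : Type*} [Category* D] [Abelian D]
    [HasProjectiveResolutions C] {S : ShortComplex C} (hS : S.ShortExact)
    [Projective S.X₁] [Projective S.X₂] (F : C ⥤ D) [F.Additive] :
    (∀ i : ℕ, 0 < i → IsZero ((F.leftDerived i).obj S.X₃)) ↔ Mono (F.map S.f) := by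
  let K := (F.mapHomologicalComplex _).obj (twoTermComplex S.f)
  have exactAt_iff (i : ℕ) : IsZero ((F.leftDerived i).obj S.X₃) ↔ K.ExactAt i := by
    rw [exactAt_iff_isZero_homology]
    exact ((shortProjectiveResolution hS).isoLeftDerivedObj F i).isZero_iff
  have mono_iff : Mono (K.d 1 0) ↔ Mono (F.map S.f) :=
    iff_of_eq (congrArg (fun φ : S.X₁ ⟶ S.X₂ => Mono (F.map φ)) (twoTermComplex_d S.f))
  have hK (n : ℕ) : IsZero (K.X (n + 2)) := F.map_isZero (isZero_twoTermComplex_X S.f n)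
  refine Iff.trans ?_ ((forall_exactAt_succ_iff_mono K hK).trans mono_iff)
  simp only [exactAt_iff]
  exact ⟨fun h n => h (n + 1) n.succ_pos, fun h i hi => Nat.succ_pred_eq_of_pos hi ▸ h i.pred⟩

end ShortResolution

section Tor

variable {T : Type u} [CommRing T] {f : T}

lemma exact_lsmul_mkQ_span_singleton (f : T) :
    Function.Exact (LinearMap.lsmul T T f) (Submodule.mkQ (Ideal.span {f})) := by
  intro x
  simp only [Submodule.mkQ_apply, Submodule.Quotient.mk_eq_zero, Ideal.mem_span_singleton',
    Set.mem_range, LinearMap.lsmul_apply, smul_eq_mul, mul_comm]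

lemma isZero_tor_quotient_span_singleton_iff (hf : f ∈ nonZeroDivisors T)
    (M : Type u) [AddCommGroup M] [Module T M] :
    (∀ i : ℕ, 0 < i → CategoryTheory.Limits.IsZero
      (((CategoryTheory.Tor (ModuleCat.{u} T) i).obj (ModuleCat.of T M)).obj
        (ModuleCat.of T (T ⧸ Ideal.span {f})))) ↔ IsSMulRegular M f := by
  have hexact := exact_lsmul_mkQ_span_singleton f
  have hS := ModuleCat.shortComplex_shortExact
    (ModuleCat.shortComplexOfCompEqZero _ _ hexact.linearMap_comp_eq_zero) hexact
    (fun _ _ => (mul_cancel_left_mem_nonZeroDivisors hf).1) (Submodule.mkQ_surjective _)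
  refine (isZero_leftDerived_iff_mono (hS := hS)
    ((CategoryTheory.MonoidalCategory.tensoringLeft (ModuleCat.{u} T)).obj (.of T M))).trans ?_
  rw [ModuleCat.mono_iff_injective, ← (TensorProduct.rid T M).isSMulRegular_congr]
  have lTensor_lsmul : (LinearMap.lsmul T T f).lTensor M = f • LinearMap.id :=
    (LinearMap.lTensor_smul M f LinearMap.id).trans (congrArg (f • ·) (LinearMap.lTensor_id M T))
  exact iff_of_eq (congrArg (fun φ : M ⊗[T] T →ₗ[T] M ⊗[T] T => Function.Injective φ) lTensor_lsmul)

end Tor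

section Lifting

variable {T : Type u} [CommRing T] {f : T} {I : Ideal T}

lemma weaklyLiftable_of_retraction {R : Type u} [CommRing R] [Algebra T R]
    {M' M : Type u} [AddCommGroup M'] [Module T M'] [AddCommGroup M] [Module R M]
    [Module.Finite T M']
    (htor : ∀ i : ℕ, 0 < i → CategoryTheory.Limits.IsZero
      (((CategoryTheory.Tor (ModuleCat.{u} T) i).obj (ModuleCat.of T M')).obj (ModuleCat.of T R)))
    (π : R ⊗[T] M' →ₗ[R] M) (σ : M →ₗ[R] R ⊗[T] M') (h : π ∘ₗ σ = LinearMap.id) :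
    WeaklyLiftable T R M := by
  let e := (π.exact_subtype_ker_map.splitSurjectiveEquiv (Submodule.injective_subtype _) ⟨σ, h⟩).1
  exact ⟨R ⊗[T] M', inferInstance, inferInstance, LinearMap.ker π, inferInstance, inferInstance,
    ⟨M', inferInstance, inferInstance, inferInstance, ⟨LinearEquiv.refl _ _⟩, htor⟩,
    ⟨e.trans (LinearEquiv.prodComm _ _ _)⟩⟩

lemma exists_linearMap_of_forall_exists_smul_eq {M N : Type*} [AddCommGroup M] [Module T M]
    [AddCommGroup N] [Module T N] (hfI : f ∈ I) (hM : IsSMulRegular M f) {m : M}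
    (hm : ∀ i ∈ I, ∃ x : M, f • x = i • m) (π : M →ₗ[T] N) :
    ∃ φ : I →ₗ[T] N, φ ⟨f, hfI⟩ = π m := by
  let g : M →ₗ[T] M := LinearMap.lsmul T M f
  let ψ : I →ₗ[T] LinearMap.range g :=
    (LinearMap.toSpanSingleton T M m ∘ₗ I.subtype).codRestrict _ fun i => hm i i.2
  let e := LinearEquiv.ofInjective g hM
  have ψ_apply : ψ ⟨f, hfI⟩ = e m := rfl
  exact ⟨π ∘ₗ e.symm.toLinearMap ∘ₗ ψ, by simp [ψ_apply]⟩

section ScalarTower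

variable [Module (T ⧸ Ideal.span {f}) (T ⧸ I)] [IsScalarTower T (T ⧸ Ideal.span {f}) (T ⧸ I)]

lemma exists_linearMap_of_weaklyLiftable (hf : f ∈ nonZeroDivisors T) (hfI : f ∈ I)
    (h : WeaklyLiftable T (T ⧸ Ideal.span {f}) (T ⧸ I)) :
    ∃ φ : I →ₗ[T] T ⧸ I, φ ⟨f, hfI⟩ = 1 := by
  obtain ⟨L, _, _, N, _, _, ⟨M', _, _, _, ⟨e₁⟩, htor⟩, ⟨e₂⟩⟩ := h
  let e := e₁.trans e₂
  let ι := TensorProduct.mk T (T ⧸ Ideal.span {f}) M' 1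
  let π : M' →ₗ[T] T ⧸ I := (LinearMap.fst _ _ _ ∘ₗ e.toLinearMap).restrictScalars T ∘ₗ ι
  obtain ⟨m, hm⟩ := TensorProduct.mk_surjective T M' _ Ideal.Quotient.mk_surjective
    (e.symm (1, 0))
  have π_m : π m = 1 := by simp [π, ι, hm]
  have smul_mem (i : T) (hi : i ∈ I) : ∃ x : M', f • x = i • m := by
    have smul_one : algebraMap T (T ⧸ Ideal.span {f}) i • (1 : T ⧸ I) = 0 := by
      rw [algebraMap_smul, ← Algebra.algebraMap_eq_smul_one]
      exact Ideal.Quotient.eq_zero_iff_mem.2 hi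
    have : i • m ∈ LinearMap.ker ι := by
      rw [LinearMap.mem_ker, map_smul, hm, ← algebraMap_smul (T ⧸ Ideal.span {f}), ← map_smul,
        Prod.smul_mk, smul_one, smul_zero, Prod.mk_zero_zero, map_zero]
    rw [LinearMap.ker_tensorProductMk, Submodule.ideal_span_singleton_smul,
      Submodule.mem_smul_pointwise_iff_exists] at this
    obtain ⟨x, -, hx⟩ := this
    exact ⟨x, hx⟩
  rw [← π_m]
  exact exists_linearMap_of_forall_exists_smul_eq hfI
    ((isZero_tor_quotient_span_singleton_iff hf M').1 htor) smul_mem π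

lemma weaklyLiftable_of_linearMap (hf : f ∈ nonZeroDivisors T) (hfI : f ∈ I) (hI : I.FG)
    {φ : I →ₗ[T] T ⧸ I} (hφ : φ ⟨f, hfI⟩ = 1) :
    WeaklyLiftable T (T ⧸ Ideal.span {f}) (T ⧸ I) := by
  have : Module.Finite T I := .of_fg hI
  have regular : IsSMulRegular I f := fun a b h =>
    Subtype.ext ((mul_cancel_left_mem_nonZeroDivisors hf).1 (congrArg Subtype.val h))
  let ι := TensorProduct.mk T (T ⧸ Ideal.span {f}) I 1
  have le_ker : I ≤ LinearMap.ker (LinearMap.toSpanSingleton T _ (ι ⟨f, hfI⟩)) := fun i hi => by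
    have : ι (f • ⟨i, hi⟩) = 0 := by
      rw [← LinearMap.mem_ker, LinearMap.ker_tensorProductMk]
      exact Submodule.smul_mem_smul (Ideal.mem_span_singleton_self f) trivial
    rw [LinearMap.mem_ker, LinearMap.toSpanSingleton_apply, ← map_smul, ← this]
    exact congrArg ι (Subtype.ext (mul_comm _ _))
  let σ : (T ⧸ I) →ₗ[T] (T ⧸ Ideal.span {f}) ⊗[T] I := Submodule.liftQ I _ le_ker
  let π : (T ⧸ Ideal.span {f}) ⊗[T] I →ₗ[T ⧸ Ideal.span {f}] T ⧸ I :=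
    TensorProduct.AlgebraTensorModule.lift
      ((LinearMap.lsmul (T ⧸ Ideal.span {f}) (I →ₗ[T] T ⧸ I)).flip φ)
  refine weaklyLiftable_of_retraction ((isZero_tor_quotient_span_singleton_iff hf I).2 regular) π
    (σ.extendScalarsOfSurjective Ideal.Quotient.mk_surjective) (LinearMap.ext fun x => ?_)
  obtain ⟨t, rfl⟩ := Ideal.Quotient.mk_surjective x
  have π_ι : π (ι ⟨f, hfI⟩) = 1 := by simp [π, ι, hφ]
  change π.restrictScalars T (t • ι ⟨f, hfI⟩) = _
  rw [map_smul, LinearMap.restrictScalars_apply, π_ι, ← Algebra.algebraMap_eq_smul_one]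
  rfl

end ScalarTower

lemma quotientWeaklyLiftable_iff (hf : f ∈ nonZeroDivisors T) (hfI : f ∈ I) (hI : I.FG) :
    QuotientWeaklyLiftable I f hfI ↔ ∃ φ : I →ₗ[T] T ⧸ I, φ ⟨f, hfI⟩ = 1 := by
  let : Module (T ⧸ Ideal.span {f}) (T ⧸ I) := Module.compHom (T ⧸ I) (quotMap hfI)
  have : IsScalarTower T (T ⧸ Ideal.span {f}) (T ⧸ I) :=
    .of_algebraMap_smul fun t x => by rw [Algebra.smul_def]; rfl
  exact ⟨exists_linearMap_of_weaklyLiftable hf hfI,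
    fun ⟨_, hφ⟩ => weaklyLiftable_of_linearMap hf hfI hI hφ⟩

end Lifting

section Splitting

variable {T : Type u} [CommRing T] {I : Ideal T} {f : T}

lemma linearMap_quotient_eq_id {h : (T ⧸ I) →ₗ[T] T ⧸ I} (h_one : h 1 = 1) :
    h = LinearMap.id :=
  Submodule.linearMap_qext I (LinearMap.ext_ring h_one)

lemma smul_top_le_ker {J : Ideal T} (hJ : J ≤ I) (φ : I →ₗ[T] T ⧸ I) :
    (J • ⊤ : Submodule T I) ≤ LinearMap.ker φ := by
  refine Submodule.smul_le.2 fun r hr n _ => ?_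
  rw [LinearMap.mem_ker, map_smul, Algebra.smul_def, Ideal.Quotient.algebraMap_eq,
    Ideal.Quotient.eq_zero_iff_mem.2 (hJ hr), zero_mul]

lemma splits_iff_exists_linearMap {J : Ideal T} (hJ : J ≤ I) (hfI : f ∈ I)
    {h : (T ⧸ I) →ₗ[T] I ⧸ (J • ⊤ : Submodule T I)} (h_one : h 1 = Submodule.mkQ _ ⟨f, hfI⟩) :
    Splits h ↔ ∃ φ : I →ₗ[T] T ⧸ I, φ ⟨f, hfI⟩ = 1 := by
  constructor
  · rintro ⟨s, hs⟩
    exact ⟨s ∘ₗ Submodule.mkQ _, by simpa [h_one] using LinearMap.congr_fun hs 1⟩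
  · rintro ⟨φ, hφ⟩
    exact ⟨Submodule.liftQ _ φ (smul_top_le_ker hJ φ),
      linearMap_quotient_eq_id (by simp [h_one, hφ])⟩

lemma splits_mapToModF_iff (hfI : f ∈ I) :
    Splits (mapToModF I f hfI) ↔ ∃ φ : I →ₗ[T] T ⧸ I, φ ⟨f, hfI⟩ = 1 :=
  splits_iff_exists_linearMap ((Ideal.span_singleton_le_iff_mem I).2 hfI) hfI
    (one_smul T (Submodule.mkQ (Ideal.span {f} • ⊤ : Submodule T I) ⟨f, hfI⟩))

lemma splits_mapToCotangent_iff (hfI : f ∈ I) :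
    Splits (mapToCotangent I f hfI) ↔ ∃ φ : I →ₗ[T] T ⧸ I, φ ⟨f, hfI⟩ = 1 :=
  splits_iff_exists_linearMap le_rfl hfI
    (one_smul T (Submodule.mkQ (I • ⊤ : Submodule T I) ⟨f, hfI⟩))

end Splitting

section Presentation

variable {T : Type u} [CommRing T] {I : Ideal T} {k m n : ℕ}

lemma IsPresentation.exists_of_isNoetherianRing [IsNoetherianRing T] (v : Fin k → T) :
    ∃ (m : ℕ) (X : Matrix (Fin k) (Fin m) T), IsPresentation v X := by
  obtain ⟨m, g, hg⟩ := Submodule.fg_iff_exists_fin_generating_family.1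
    (IsNoetherian.noetherian (LinearMap.ker (Fintype.linearCombination T v)))
  refine ⟨m, Matrix.of fun i j => g j i, LinearMap.exact_iff.2 ?_⟩
  rw [← hg, Matrix.range_mulVecLin]
  rfl

lemma IsPresentation.exists_linearMap_iff {v : Fin k → T} {X : Matrix (Fin k) (Fin m) T}
    (hX : IsPresentation v X) (hI : Ideal.span (Set.range v) = I) (hv : ∀ i, v i ∈ I)
    {N : Type*} [AddCommGroup N] [Module T N] (y : Fin k → N) :
    (∃ φ : I →ₗ[T] N, ∀ i, φ ⟨v i, hv i⟩ = y i) ↔ ∀ j, ∑ i, X i j • y i = 0 := by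
  let V : (Fin k → T) →ₗ[T] I := Fintype.linearCombination T fun i => ⟨v i, hv i⟩
  have subtype_V : I.subtype ∘ₗ V = Fintype.linearCombination T v :=
    LinearMap.ext fun z => by simp [V, Fintype.linearCombination_apply]
  have surjective_V : LinearMap.range V = ⊤ := by
    refine Submodule.map_injective_of_injective I.subtype_injective ?_
    rw [← LinearMap.range_comp, subtype_V, Fintype.range_linearCombination, Submodule.map_top,
      Submodule.range_subtype]
    exact hI
  have ker_V : LinearMap.ker V = LinearMap.range X.mulVecLin := by
    rw [← LinearMap.exact_iff.1 hX, ← subtype_V, LinearMap.ker_comp_of_ker_eq_bot _ I.ker_subtype]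
  have relations_iff : (∀ j, ∑ i, X i j • y i = 0) ↔
      LinearMap.ker V ≤ LinearMap.ker (Fintype.linearCombination T y) := by
    rw [ker_V, Matrix.range_mulVecLin, Submodule.span_le, Set.range_subset_iff]
    rfl
  rw [relations_iff]
  constructor
  · rintro ⟨φ, hφ⟩
    have : φ ∘ₗ V = Fintype.linearCombination T y :=
      LinearMap.pi_ext' fun i => LinearMap.ext_ring (by simp [V, hφ])
    exact this ▸ LinearMap.ker_le_ker_comp V φ
  · intro h
    let e := V.quotKerEquivOfSurjective (LinearMap.range_eq_top.1 surjective_V)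
    refine ⟨Submodule.liftQ _ _ h ∘ₗ e.symm.toLinearMap, fun i => ?_⟩
    have e_single : e (Submodule.mkQ _ (Pi.single i 1)) = ⟨v i, hv i⟩ := by simp [e, V]
    simp [← e_single]

lemma mem_ideal_smul_top_pi_iff {z : Fin m → T} :
    z ∈ (I • ⊤ : Submodule T (Fin m → T)) ↔ ∀ j, z j ∈ I := by
  constructor
  · intro hz j
    have h : (I • ⊤ : Submodule T (Fin m → T)) ≤ Submodule.comap (LinearMap.proj j) I :=
      Submodule.smul_le.2 fun r hr n _ => I.mul_mem_right _ hr
    exact h hz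
  · intro hz
    rw [pi_eq_sum_univ' z]
    exact Submodule.sum_mem _ fun j _ => Submodule.smul_mem_smul (hz j) trivial

lemma rowCondition_iff_mem_span {X : Matrix (Fin (n + 1)) (Fin m) T} :
    RowCondition I X ↔ Ideal.Quotient.mk I ∘ X 0 ∈
      Submodule.span (T ⧸ I) (Set.range fun i : Fin n => Ideal.Quotient.mk I ∘ X i.succ) := by
  rw [Submodule.mem_span_range_iff_exists_fun,
    (Ideal.Quotient.mk_surjective (I := I)).comp_left.exists, RowCondition]
  refine exists_congr fun x => ?_
  simp only [mem_ideal_smul_top_pi_iff, ← Ideal.Quotient.eq_zero_iff_mem, funext_iff]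
  exact forall_congr' fun j => by simpa [sub_eq_zero] using eq_comm

lemma IsPresentation.rowCondition_iff {f : T} {fs : Fin n → T} {X : Matrix (Fin (n + 1)) (Fin m) T}
    (hX : IsPresentation (Fin.cons f fs : Fin (n + 1) → T) X)
    (hI : Ideal.span (Set.range (Fin.cons f fs : Fin (n + 1) → T)) = I) (hfI : f ∈ I) :
    RowCondition I X ↔ ∃ φ : I →ₗ[T] T ⧸ I, φ ⟨f, hfI⟩ = 1 := by
  have hv (i : Fin (n + 1)) : (Fin.cons f fs : Fin (n + 1) → T) i ∈ I :=
    hI ▸ Ideal.subset_span ⟨i, rfl⟩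
  have exists_linearMap_iff (c : Fin n → T ⧸ I) :
      ∑ i, c i • (Ideal.Quotient.mk I ∘ X i.succ) = Ideal.Quotient.mk I ∘ X 0 ↔
        ∃ φ : I →ₗ[T] T ⧸ I, ∀ i, φ ⟨_, hv i⟩ = (Fin.cons 1 (-c) : Fin (n + 1) → T ⧸ I) i := by
    rw [hX.exists_linearMap_iff hI hv, funext_iff]
    refine forall_congr' fun j => ?_
    simpa [Fin.sum_univ_succ, Algebra.smul_def, ← sub_eq_add_neg, sub_eq_zero, mul_comm]
      using eq_comm
  rw [rowCondition_iff_mem_span, Submodule.mem_span_range_iff_exists_fun]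
  constructor
  · rintro ⟨c, hc⟩
    obtain ⟨φ, hφ⟩ := (exists_linearMap_iff c).1 hc
    exact ⟨φ, hφ 0⟩
  · rintro ⟨φ, hφ⟩
    exact ⟨fun i => -φ ⟨_, hv i.succ⟩, (exists_linearMap_iff _).2
      ⟨φ, Fin.cases hφ fun i => by simp⟩⟩

end Presentation

section Colon

variable {T : Type u} [CommRing T]

lemma colon_le_sup_of_linearMap {f : T} {I : Ideal T} {hfI : f ∈ I} {φ : I →ₗ[T] T ⧸ I}
    (hφ : φ ⟨f, hfI⟩ = 1) (J : Ideal T) : (I * J).colon {f} ≤ J ⊔ I := by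
  have mul_le : I * J ≤
      (((J.map (Ideal.Quotient.mk I)).restrictScalars T).comap φ).map I.subtype := by
    refine Ideal.mul_le.2 fun i hi j hj => ⟨j • ⟨i, hi⟩, ?_, mul_comm j i⟩
    rw [SetLike.mem_coe, Submodule.mem_comap, map_smul, Algebra.smul_def]
    exact Ideal.mul_mem_right _ _ (Ideal.mem_map_of_mem _ hj)
  intro a ha
  obtain ⟨y, hy, hya⟩ := mul_le (Submodule.mem_colon_singleton.1 ha)
  obtain rfl : y = a • ⟨f, hfI⟩ := Subtype.ext hya
  rw [SetLike.mem_coe, Submodule.mem_comap, map_smul, hφ, ← Algebra.algebraMap_eq_smul_one] at hy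
  rw [← I.mk_ker, ← Ideal.comap_map_of_surjective' _ Ideal.Quotient.mk_surjective]
  exact hy

lemma forall_colon_le_sup_iff (I : Ideal T) (f : T) :
    (∀ J : Ideal T, (I * J).colon {f} ≤ J ⊔ I) ↔
      ∀ J : Ideal T, I ≤ J → (I * J).colon {f} ≤ J := by
  refine ⟨fun h J hJ => (h J).trans (sup_le le_rfl hJ), fun h J => ?_⟩
  exact (Submodule.colon_mono (Ideal.mul_mono le_rfl le_sup_left) subset_rfl).trans
    (h (J ⊔ I) le_sup_right)

lemma forall_colon_le_iff_forall_infIrred [IsNoetherianRing T] (I : Ideal T) (f : T) :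
    (∀ J : Ideal T, I ≤ J → (I * J).colon {f} ≤ J) ↔
      ∀ J : Ideal T, InfIrred J → I ≤ J → (I * J).colon {f} ≤ J := by
  refine ⟨fun h J _ => h J, fun h J hJ => ?_⟩
  obtain ⟨s, rfl, hs⟩ := exists_infIrred_decomposition J
  refine Finset.le_inf fun K hK => ?_
  have inf_le : s.inf id ≤ K := Finset.inf_le (f := id) hK
  exact (Submodule.colon_mono (Ideal.mul_mono le_rfl inf_le) subset_rfl).trans
    (h K (hs hK) (hJ.trans inf_le))

end Colon

section InjectiveDimension

open CategoryTheory Abelian RingTheory.Sequence IsLocalRing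

variable {S : Type u} [CommRing S]

lemma ext_comp_smulShortComplex_f {N : ModuleCat.{u} S} {x : S} (hx : x ∈ Module.annihilator S N)
    {M : ModuleCat.{u} S} {i : ℕ} (e : Ext N M i) :
    e.comp (Ext.mk₀ (M.smulShortComplex x).f) (add_zero i) = 0 :=
  DFunLike.congr_fun (congrArg AddCommGrpCat.Hom.hom
    (Ext.postcomp_smul_id_eq_zero_of_mem_annihilator (M := M) hx i)) e

lemma subsingleton_ext_of_isWeaklyRegular {N M : ModuleCat.{u} S} {rs : List S}
    (hN : ∀ r ∈ rs, r ∈ Module.annihilator S N) (hM : IsWeaklyRegular M rs) :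
    ∀ i < rs.length, Subsingleton (Ext N M i) := by
  induction rs generalizing M with
  | nil => simp
  | cons x rs ih =>
    obtain ⟨hx, hrs⟩ := (isWeaklyRegular_cons_iff M x rs).1 hM
    have x_mem := hN x List.mem_cons_self
    rintro (_ | i) hi
    · have := IsSMulRegular.linearMap_subsingleton_of_mem_annihilator hx x_mem
      exact (Ext.homEquiv₀.trans ModuleCat.homEquiv).subsingleton
    · have : Subsingleton (Ext N (M.smulShortComplex x).X₃ i) :=
        ih (fun r hr => hN r (List.mem_cons_of_mem x hr)) hrs i (Nat.lt_of_succ_lt_succ hi)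
      refine subsingleton_of_forall_eq 0 fun e => ?_
      obtain ⟨e', rfl⟩ := Ext.covariant_sequence_exact₁ N hx.smulShortComplex_shortExact e
        (ext_comp_smulShortComplex_f x_mem e) rfl
      exact by rw [Subsingleton.elim e' 0, Ext.zero_comp]; rfl

lemma ext_quotSMulTop_precomp_surjective {N' N M : ModuleCat.{u} S} (ι : N' ⟶ N) {x : S}
    (hN : x ∈ Module.annihilator S N) (hM : IsSMulRegular M x) {n : ℕ}
    [Subsingleton (Ext N' M n)]
    (surj : Function.Surjective fun e : Ext N M (n + 1) => (Ext.mk₀ ι).comp e (zero_add _)) :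
    Function.Surjective fun e : Ext N (ModuleCat.of S (QuotSMulTop x M)) n =>
      (Ext.mk₀ ι).comp e (zero_add n) := by
  intro (a : Ext N' (M.smulShortComplex x).X₃ n)
  have exact := hM.smulShortComplex_shortExact
  obtain ⟨b, hb⟩ := surj (a.comp exact.extClass rfl)
  obtain ⟨c, rfl⟩ := Ext.covariant_sequence_exact₁ N exact b (ext_comp_smulShortComplex_f hN b) rfl
  have extClass_eq_zero :
      ((Ext.mk₀ ι).comp c (zero_add n) - a).comp exact.extClass (rfl : n + 1 = n + 1) = 0 := by
    rw [sub_eq_add_neg, Ext.add_comp, Ext.neg_comp, ← sub_eq_add_neg, sub_eq_zero,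
      Ext.comp_assoc _ _ _ (zero_add n) rfl (by omega)]
    exact hb
  obtain ⟨z, hz⟩ := Ext.covariant_sequence_exact₃ N' exact _ rfl extClass_eq_zero
  have z_eq_zero : z = 0 := Subsingleton.elim (α := Ext N' M n) z 0
  rw [z_eq_zero, Ext.zero_comp] at hz
  exact ⟨c, sub_eq_zero.1 hz.symm⟩

lemma exists_comp_eq_of_ext_surjective {N' N M : ModuleCat.{u} S} (ι : N' ⟶ N) {rs : List S}
    (hN' : ∀ r ∈ rs, r ∈ Module.annihilator S N') (hN : ∀ r ∈ rs, r ∈ Module.annihilator S N)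
    (hM : IsWeaklyRegular M rs)
    (surj : Function.Surjective fun e : Ext N M rs.length => (Ext.mk₀ ι).comp e (zero_add _))
    (g : N' →ₗ[S] M ⧸ (Ideal.ofList rs • ⊤ : Submodule S M)) :
    ∃ g' : N →ₗ[S] M ⧸ (Ideal.ofList rs • ⊤ : Submodule S M), g' ∘ₗ ι.hom = g := by
  induction rs generalizing M with
  | nil =>
    let q : (M ⧸ (Ideal.ofList ([] : List S) • ⊤ : Submodule S M)) ≃ₗ[S] M :=
      Submodule.quotEquivOfEqBot _ (by simp)
    obtain ⟨e, he⟩ := surj (Ext.mk₀ (ModuleCat.ofHom (q.toLinearMap ∘ₗ g)))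
    obtain ⟨h, rfl⟩ := Ext.homEquiv₀.symm.surjective e
    have h_comp : ι ≫ h = ModuleCat.ofHom (q.toLinearMap ∘ₗ g) :=
      Ext.homEquiv₀.symm.injective ((Ext.mk₀_comp_mk₀ ι h).symm.trans he)
    refine ⟨q.symm.toLinearMap ∘ₗ h.hom, LinearMap.ext fun z => q.injective ?_⟩
    simpa using LinearMap.congr_fun (congrArg ModuleCat.Hom.hom h_comp) z
  | cons x rs ih =>
    obtain ⟨hx, hrs⟩ := (isWeaklyRegular_cons_iff M x rs).1 hM
    let q := Submodule.quotOfListConsSMulTopEquivQuotSMulTopInner M x rs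
    have := subsingleton_ext_of_isWeaklyRegular hN' hM rs.length (Nat.lt_succ_self _)
    obtain ⟨g', hg'⟩ := ih (fun r hr => hN' r (List.mem_cons_of_mem x hr))
      (fun r hr => hN r (List.mem_cons_of_mem x hr)) hrs
      (ext_quotSMulTop_precomp_surjective ι (hN x List.mem_cons_self) hx surj) (q.toLinearMap ∘ₗ g)
    refine ⟨q.symm.toLinearMap ∘ₗ g', LinearMap.ext fun z => q.injective ?_⟩
    simpa using LinearMap.congr_fun hg' z

lemma ext_precomp_surjective {M : ModuleCat.{u} S} {d : ℕ}
    (h : ∀ N : ModuleCat.{u} S, Module.Finite S N → Subsingleton (Ext N M (d + 1)))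
    {N' N : ModuleCat.{u} S} [Module.Finite S N] (ι : N' ⟶ N) [Mono ι] :
    Function.Surjective fun e : Ext N M d => (Ext.mk₀ ι).comp e (zero_add d) := by
  intro e
  have exact : (ShortComplex.mk ι (Limits.cokernel.π ι) (Limits.cokernel.condition ι)).ShortExact :=
    { exact := ShortComplex.exact_cokernel ι }
  have := h (Limits.cokernel ι) (.of_surjective _
    ((ModuleCat.epi_iff_surjective (Limits.cokernel.π ι)).1 inferInstance))
  exact Ext.contravariant_sequence_exact₁ exact M e (add_comm 1 d) (Subsingleton.elim _ _)

section Local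

variable [IsLocalRing S] [IsNoetherianRing S]

lemma subsingleton_ext_of_isSMulRegular {N M : ModuleCat.{u} S} [Module.Finite S N]
    [Module.Finite S M] {d : ℕ}
    (h : ∀ N : ModuleCat.{u} S, Module.Finite S N → Subsingleton (Ext N M (d + 1)))
    {x : S} (x_mem : x ∈ maximalIdeal S) (hx : IsSMulRegular N x) : Subsingleton (Ext N M d) := by
  have : Mono (x • 𝟙 N) := (ModuleCat.mono_iff_injective _).2 hx
  have le_smul : (⊤ : Submodule S (Ext N M d)) ≤ maximalIdeal S • ⊤ := by
    intro e _
    obtain ⟨e', rfl⟩ := ext_precomp_surjective h (x • 𝟙 N) e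
    simp only [Ext.mk₀_smul, Ext.smul_comp, Ext.mk₀_id_comp]
    exact Submodule.smul_mem_smul x_mem trivial
  have eq_bot := Submodule.eq_bot_of_le_smul_of_le_jacobson_bot (maximalIdeal S) _
    Module.Finite.fg_top le_smul (maximalIdeal_le_jacobson _)
  exact (Submodule.subsingleton_iff S).1 (subsingleton_of_bot_eq_top eq_bot.symm)

lemma subsingleton_ext_of_residueField {M : ModuleCat.{u} S} [Module.Finite S M] {d : ℕ}
    (h : ∀ N : ModuleCat.{u} S, Module.Finite S N → Subsingleton (Ext N M (d + 1)))
    (hk : Subsingleton (Ext (ModuleCat.of S (S ⧸ maximalIdeal S)) M d))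
    (N : ModuleCat.{u} S) (hN : Module.Finite S N) : Subsingleton (Ext N M d) := by
  suffices ∀ (N : Type u) [AddCommGroup N] [Module S N] [Module.Finite S N],
      Subsingleton (Ext (ModuleCat.of S N) M d) from this N
  intro N _ _ hN
  induction hN using IsNoetherianRing.induction_on_isQuotientEquivQuotientPrime S with
  | subsingleton N =>
    refine subsingleton_of_forall_eq 0 fun e => ?_
    have N_zero : Limits.IsZero (ModuleCat.of S N) := ModuleCat.isZero_of_subsingleton _
    rw [← e.mk₀_id_comp, N_zero.eq_zero_of_src (𝟙 _), Ext.mk₀_zero, Ext.zero_comp]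
  | quotient N p e =>
    by_cases hp : p.asIdeal = maximalIdeal S
    · let iso : ModuleCat.of S (S ⧸ maximalIdeal S) ≅ ModuleCat.of S N :=
        (e.trans (Submodule.quotEquivOfEq _ _ hp)).symm.toModuleIso
      refine subsingleton_of_forall_eq 0 fun e' => ?_
      rw [← e'.mk₀_id_comp, ← iso.inv_hom_id, ← Ext.mk₀_comp_mk₀_assoc, Subsingleton.elim
        ((Ext.mk₀ iso.hom).comp e' (zero_add d)) 0, Ext.comp_zero]
    obtain ⟨x, x_mem, hx⟩ := SetLike.exists_of_lt
      (lt_of_le_of_ne (le_maximalIdeal p.isPrime.ne_top) hp)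
    refine subsingleton_ext_of_isSMulRegular h x_mem ((e.isSMulRegular_congr x).2 ?_)
    refine isSMulRegular_iff_right_eq_zero_of_smul.2 fun y hy => ?_
    rw [Algebra.smul_def] at hy
    exact (mul_eq_zero.1 hy).resolve_left (mt Ideal.Quotient.eq_zero_iff_mem.1 hx)
  | exact N₁ N₂ N₃ f g hf hg hfg h₁ h₃ =>
    have exact := ModuleCat.shortComplex_shortExact
      (ModuleCat.shortComplexOfCompEqZero f g hfg.linearMap_comp_eq_zero) hfg hf hg
    refine subsingleton_of_forall_eq 0 fun e => ?_
    obtain ⟨e', rfl⟩ := Ext.contravariant_sequence_exact₂ exact M e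
      (Subsingleton.elim (α := Ext (ModuleCat.of S N₁) M d) _ _)
    rw [Subsingleton.elim (α := Ext (ModuleCat.of S N₃) M d) e' 0, Ext.comp_zero]

lemma exists_isRegular_injective (N : ℕ) : ∃ rs : List S, IsRegular S rs ∧
    (∀ r ∈ rs, r ∈ maximalIdeal S ^ (N + 1)) ∧
    ∃ ι : (S ⧸ maximalIdeal S) →ₗ[S] S ⧸ (Ideal.ofList rs • ⊤ : Submodule S S),
      Function.Injective ι := by
  obtain ⟨rs, ⟨hrs, mem⟩, maximal⟩ := exists_maximalFor_of_wellFoundedGT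
    (fun rs : List S => IsRegular S rs ∧ ∀ r ∈ rs, r ∈ maximalIdeal S ^ (N + 1))
    (fun rs => (Ideal.ofList rs • ⊤ : Submodule S S)) ⟨[], .nil S S, by simp⟩
  refine ⟨rs, hrs, mem, ?_⟩
  set M := S ⧸ (Ideal.ofList rs • ⊤ : Submodule S S)
  -- If no such map exists, some power of an `M`-regular element of the maximal ideal extends `rs`.
  by_contra! not_injective
  have : IsSimpleModule S (S ⧸ maximalIdeal S) :=
    isSimpleModule_iff_isCoatom.2 (maximalIdeal.isMaximal S).out
  have : Subsingleton ((S ⧸ maximalIdeal S) →ₗ[S] M) :=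
    subsingleton_of_forall_eq 0 fun ι => (LinearMap.injective_or_eq_zero ι).resolve_left
      (not_injective ι)
  obtain ⟨x, hx, x_reg⟩ := IsSMulRegular.subsingleton_linearMap_iff.1 this
  rw [Ideal.annihilator_quotient] at hx
  have y_mem := Ideal.pow_mem_pow hx (N + 1)
  have y_reg : IsSMulRegular M (x ^ (N + 1)) := x_reg.pow _
  have mem' : ∀ r ∈ rs ++ [x ^ (N + 1)], r ∈ maximalIdeal S ^ (N + 1) := by
    simpa [or_imp, forall_and, y_mem] using mem
  have hrs' : IsRegular S (rs ++ [x ^ (N + 1)]) :=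
    IsRegular.of_isWeaklyRegular_of_mem_maximalIdeal S
      (fun r hr => Ideal.pow_le_self N.succ_ne_zero (mem' r hr))
      ((isWeaklyRegular_append_iff S rs _).2 ⟨hrs.1, (isWeaklyRegular_singleton_iff _ _).2 y_reg⟩)
  have y_mem_ofList : x ^ (N + 1) ∈ (Ideal.ofList rs • ⊤ : Submodule S S) := by
    refine maximal ⟨hrs', mem'⟩ (Submodule.smul_mono_left ?_) ?_
    · exact (Ideal.ofList_append rs _).symm ▸ le_sup_left
    · simp [Ideal.ofList_append, Ideal.mem_sup_right]
  have y_smul_one : x ^ (N + 1) • (Submodule.Quotient.mk 1 : M) = 0 :=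
    (Submodule.Quotient.mk_eq_zero _ (x := x ^ (N + 1) • 1)).2 (by simpa using y_mem_ofList)
  have one_eq_zero : (Submodule.Quotient.mk 1 : M) = 0 :=
    y_reg (y_smul_one.trans (smul_zero _).symm)
  exact hrs.2 ((Ideal.eq_top_iff_one _).2 ((Submodule.Quotient.mk_eq_zero _).1 one_eq_zero)).symm

lemma subsingleton_ext_length_succ {n : ℕ} (hn : HasInjectiveDimensionLE (ModuleCat.of S S) n)
    {rs : List S} (hrs : IsRegular S rs)
    {ι : (S ⧸ maximalIdeal S) →ₗ[S] S ⧸ (Ideal.ofList rs • ⊤ : Submodule S S)}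
    (hι : Function.Injective ι) (N : ModuleCat.{u} S) (hN : Module.Finite S N) :
    Subsingleton (Ext N (ModuleCat.of S S) (rs.length + 1)) := by
  have mem : ∀ r ∈ rs, r ∈ maximalIdeal S := fun r hr => by
    refine le_maximalIdeal hrs.2.symm ?_
    rw [smul_eq_mul, Ideal.mul_top]
    exact Ideal.subset_span hr
  have pd : HasProjectiveDimensionLE
      (ModuleCat.of S (S ⧸ (Ideal.ofList rs • ⊤ : Submodule S S))) rs.length := by
    rw [← projectiveDimension_le_iff,
      ModuleCat.projectiveDimension_quotient_eq_add_length_of_isWeaklyRegular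
        (ModuleCat.of S S) rs hrs.1 mem, ModuleCat.projectiveDimension_eq_zero_of_projective,
      zero_add]
  -- Above degree `rs.length`, `Ext` from `S ⧸ (rs)` is zero and, through `ι`, surjects onto `Ext`
  -- from the residue field.
  refine Nat.decreasingInduction' (m := rs.length + 1) (n := rs.length + 1 + n)
    (P := fun d => ∀ N : ModuleCat.{u} S, Module.Finite S N → Subsingleton
      (Ext N (ModuleCat.of S S) d)) ?_ le_self_add ?_ N hN
  · intro d _ length_lt h
    have : Subsingleton
        (Ext (ModuleCat.of S (S ⧸ (Ideal.ofList rs • ⊤ : Submodule S S))) (ModuleCat.of S S) d) :=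
      HasProjectiveDimensionLT.subsingleton _ (rs.length + 1) d length_lt _
    have : Mono (ModuleCat.ofHom ι) := (ModuleCat.mono_iff_injective _).2 hι
    exact subsingleton_ext_of_residueField h
      (ext_precomp_surjective h (ModuleCat.ofHom ι)).subsingleton
  · exact fun N _ => HasInjectiveDimensionLT.subsingleton _ (n + 1) _ (by omega) _

lemma exists_injective_quotient {n : ℕ} (hn : HasInjectiveDimensionLE (ModuleCat.of S S) n)
    (N : ℕ) : ∃ 𝔮 ≤ maximalIdeal S ^ N, Module.Injective (S ⧸ 𝔮) (S ⧸ 𝔮) := by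
  obtain ⟨rs, hrs, mem, ι, hι⟩ := exists_isRegular_injective (S := S) N
  let 𝔮 : Ideal S := Ideal.ofList rs • ⊤
  have ofList_le : Ideal.ofList rs ≤ 𝔮 := by simp [𝔮]
  have annihilates (P : Type u) [AddCommGroup P] [Module S P] [Module (S ⧸ 𝔮) P]
      [IsScalarTower S (S ⧸ 𝔮) P] : ∀ r ∈ rs, r ∈ Module.annihilator S P := by
    refine fun r hr => Module.mem_annihilator.2 fun z => ?_
    rw [← IsScalarTower.algebraMap_smul (S ⧸ 𝔮), Ideal.Quotient.algebraMap_eq,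
      Ideal.Quotient.eq_zero_iff_mem.2 (ofList_le (Ideal.subset_span hr)), zero_smul]
  refine ⟨𝔮, ?_, Module.Baer.injective fun 𝔟 g => ?_⟩
  · exact Ideal.mul_le_left.trans (Ideal.span_le.2 fun r hr =>
      Ideal.pow_le_pow_right N.le_succ (mem r hr))
  let incl : ModuleCat.of S 𝔟 ⟶ ModuleCat.of S (S ⧸ 𝔮) :=
    ModuleCat.ofHom (𝔟.subtype.restrictScalars S)
  have : Mono incl := (ModuleCat.mono_iff_injective _).2 𝔟.subtype_injective
  obtain ⟨g', hg'⟩ := exists_comp_eq_of_ext_surjective (M := ModuleCat.of S S) incl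
    (annihilates 𝔟) (annihilates (S ⧸ 𝔮)) hrs.1
    (ext_precomp_surjective (subsingleton_ext_length_succ hn hrs hι) incl) (g.restrictScalars S)
  exact ⟨g'.extendScalarsOfSurjective Ideal.Quotient.mk_surjective, fun z hz =>
    LinearMap.congr_fun hg' ⟨z, hz⟩⟩

end Local

end InjectiveDimension

section SelfInjective

lemma exists_comp_eq_of_ker_le {B M N E : Type u} [CommRing B] [AddCommGroup M] [Module B M]
    [AddCommGroup N] [Module B N] [AddCommGroup E] [Module B E] [Module.Injective B E]
    (e : M →ₗ[B] N) (r : M →ₗ[B] E) (h : LinearMap.ker e ≤ LinearMap.ker r) :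
    ∃ r' : N →ₗ[B] E, r' ∘ₗ e = r := by
  obtain ⟨r', hr'⟩ := Module.Injective.extension_property B _ _ _ ((LinearMap.ker e).liftQ e le_rfl)
    (LinearMap.ker_eq_bot.1 (Submodule.ker_liftQ_eq_bot _ _ _ le_rfl)) ((LinearMap.ker e).liftQ r h)
  exact ⟨r', by rw [← (LinearMap.ker e).liftQ_mkQ r h, ← hr', LinearMap.comp_assoc,
    Submodule.liftQ_mkQ]⟩

open Matrix in
lemma mem_span_range_of_forall_dotProduct_eq_zero {B : Type u} [CommRing B] [Module.Injective B B]
    {n m : ℕ} {w : Fin n → Fin m → B} {x : Fin m → B}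
    (h : ∀ z, (∀ i, w i ⬝ᵥ z = 0) → x ⬝ᵥ z = 0) : x ∈ Submodule.span B (Set.range w) := by
  have ker_le : LinearMap.ker (Matrix.of w).mulVecLin ≤ LinearMap.ker (dotProductBilin B B x) :=
    fun z hz => h z (congrFun hz)
  obtain ⟨r, hr⟩ := exists_comp_eq_of_ker_le _ _ ker_le
  refine (Submodule.mem_span_range_iff_exists_fun B).2 ⟨fun i => r fun k => if i = k then 1 else 0,
    funext fun j => ?_⟩
  have r_col : r ((Matrix.of w).col j) = x j := by
    simpa using LinearMap.congr_fun hr (Pi.single j 1)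
  rw [← r_col, LinearMap.pi_apply_eq_sum_univ r]
  simp [mul_comm]

end SelfInjective

section TestRing

variable {T : Type u} [CommRing T] {f : T} {I : Ideal T} {n m : ℕ} {fs : Fin n → T}
  {X : Matrix (Fin (n + 1)) (Fin m) T}

lemma IsPresentation.mulVec_zero_mem (hX : IsPresentation (Fin.cons f fs : Fin (n + 1) → T) X)
    (hfs : ∀ i, fs i ∈ I) {K : Ideal T} (hK : (I * K).colon {f} ≤ K) {t : Fin m → T}
    (ht : ∀ i : Fin n, X.mulVec t i.succ ∈ K) : X.mulVec t 0 ∈ K := by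
  have relation : X.mulVec t 0 * f + ∑ i : Fin n, X.mulVec t i.succ * fs i = 0 := by
    simpa [Fintype.linearCombination_apply, Fin.sum_univ_succ] using hX.apply_apply_eq_zero t
  refine hK (Submodule.mem_colon_singleton.2 ?_)
  rw [smul_eq_mul, eq_neg_of_add_eq_zero_left relation]
  exact neg_mem (Ideal.sum_mem _ fun i _ => Ideal.mul_mem_mul_rev (hfs i) (ht i))

lemma IsPresentation.map_row_mem_span
    (hX : IsPresentation (Fin.cons f fs : Fin (n + 1) → T) X) (hfs : ∀ i, fs i ∈ I)
    {B : Type u} [CommRing B] [Module.Injective B B] (ρ : T →+* B)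
    (hρ : ∀ z : Fin m → B, ∃ s, IsUnit (ρ s) ∧ ∃ t : Fin m → T, ρ ∘ t = ρ s • z)
    (hcolon : (I * RingHom.ker ρ).colon {f} ≤ RingHom.ker ρ) :
    ρ ∘ X 0 ∈ Submodule.span B (Set.range fun i : Fin n => ρ ∘ X i.succ) := by
  refine mem_span_range_of_forall_dotProduct_eq_zero fun z hz => ?_
  obtain ⟨s, hs, t, ht⟩ := hρ z
  have map_mulVec (i : Fin (n + 1)) : ρ (X.mulVec t i) = ρ s * (ρ ∘ X i ⬝ᵥ z) := by
    rw [RingHom.map_mulVec, ht, Matrix.mulVec_smul]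
    rfl
  have mem_ker : X.mulVec t 0 ∈ RingHom.ker ρ := hX.mulVec_zero_mem hfs hcolon fun i => by
    rw [RingHom.mem_ker, map_mulVec, hz, mul_zero]
  rwa [RingHom.mem_ker, map_mulVec, hs.mul_right_eq_zero] at mem_ker

end TestRing

section ApproximatelyGorenstein

open IsLocalRing

variable {S : Type u} [CommRing S] [IsLocalRing S]

lemma IsApproxGorensteinLocal.exists_surjective_selfInjective (hS : IsApproxGorensteinLocal S)
    (N : ℕ) : ∃ (B : Type u) (_ : CommRing B) (φ : S →+* B), Module.Injective B B ∧
      Function.Surjective φ ∧ RingHom.ker φ ≤ maximalIdeal S ^ N := by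
  obtain ⟨Q, hQ, _, _, d, hd⟩ := hS N
  obtain ⟨𝔮, h𝔮, injective⟩ := exists_injective_quotient hd N
  refine ⟨_, inferInstance, (Ideal.Quotient.mk 𝔮).comp (Ideal.Quotient.mk Q), injective,
    Ideal.Quotient.mk_surjective.comp Ideal.Quotient.mk_surjective, ?_⟩
  rw [← RingHom.comap_ker, Ideal.mk_ker, ← Ideal.comap_map_mk hQ, Ideal.map_pow,
    map_maximalIdeal_of_surjective _ Ideal.Quotient.mk_surjective]
  exact Ideal.comap_mono h𝔮

lemma mem_of_forall_mem_sup_maximalIdeal_pow_smul [IsNoetherianRing S] {M : Type*} [AddCommGroup M]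
    [Module S M] [Module.Finite S M] {L : Submodule S M} {x : M}
    (h : ∀ N : ℕ, x ∈ L ⊔ (maximalIdeal S ^ N • ⊤ : Submodule S M)) : x ∈ L := by
  rw [← Submodule.Quotient.mk_eq_zero, ← Submodule.mem_bot S,
    ← Ideal.iInf_pow_smul_eq_bot_of_isLocalRing _ (maximalIdeal.isMaximal S).ne_top,
    Submodule.mem_iInf]
  intro N
  have : x ∈ ((maximalIdeal S ^ N • ⊤ : Submodule S (M ⧸ L))).comap L.mkQ := by
    rw [Submodule.comap_smul_top_of_surjective _ _ L.mkQ_surjective, Submodule.ker_mkQ, sup_comm]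
    exact h N
  exact this

lemma IsApproxGorensteinLocal.mem_span_range [IsNoetherianRing S] (hS : IsApproxGorensteinLocal S)
    {n m : ℕ} {w : Fin n → Fin m → S} {x : Fin m → S}
    (h : ∀ (B : Type u) [CommRing B] [Module.Injective B B] (φ : S →+* B), Function.Surjective φ →
      φ ∘ x ∈ Submodule.span B (Set.range fun i => φ ∘ w i)) :
    x ∈ Submodule.span S (Set.range w) := by
  refine mem_of_forall_mem_sup_maximalIdeal_pow_smul fun N => ?_
  obtain ⟨B, _, φ, _, surjective, ker_le⟩ := hS.exists_surjective_selfInjective N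
  obtain ⟨b, hb⟩ := (Submodule.mem_span_range_iff_exists_fun B).1 (h B φ surjective)
  obtain ⟨c, rfl⟩ := surjective.comp_left b
  have sub_mem : x - ∑ i, c i • w i ∈ (maximalIdeal S ^ N • ⊤ : Submodule S (Fin m → S)) := by
    refine mem_ideal_smul_top_pi_iff.2 fun j => ker_le ?_
    have := congrFun hb j
    simpa [RingHom.mem_ker, sub_eq_zero] using this.symm
  rw [← add_sub_cancel (∑ i, c i • w i) x]
  exact Submodule.add_mem_sup (Submodule.sum_smul_mem _ _ fun i _ => Submodule.subset_span ⟨i, rfl⟩)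
    sub_mem

lemma mem_span_range_of_localization_maximal {A : Type u} [CommRing A] {n m : ℕ}
    {w : Fin n → Fin m → A} {x : Fin m → A}
    (h : ∀ (q : Ideal A) [q.IsMaximal], algebraMap A (Localization.AtPrime q) ∘ x ∈
      Submodule.span (Localization.AtPrime q)
        (Set.range fun i => algebraMap A (Localization.AtPrime q) ∘ w i)) :
    x ∈ Submodule.span A (Set.range w) := by
  let ι (q : Ideal A) [q.IsMaximal] : (Fin m → A) →ₗ[A] Fin m → Localization.AtPrime q :=
    .pi fun j => Algebra.linearMap A (Localization.AtPrime q) ∘ₗ .proj j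
  refine Submodule.mem_of_localization_maximal _ (fun q _ => ι q) x _ fun q _ => ?_
  change ι q x ∈
    (Submodule.span A (Set.range w)).localized' (Localization.AtPrime q) q.primeCompl (ι q)
  rw [Submodule.localized'_span, ← Set.range_comp]
  exact h q

lemma exists_isUnit_smul_eq_comp {A : Type*} [CommRing A] (M : Submonoid A)
    {S B : Type*} [CommRing S] [Algebra A S] [IsLocalization M S] [CommRing B] {φ : S →+* B}
    (hφ : Function.Surjective φ) {m : ℕ} (z : Fin m → B) :
    ∃ s : A, IsUnit (φ (algebraMap A S s)) ∧
      ∃ t : Fin m → A, φ ∘ algebraMap A S ∘ t = φ (algebraMap A S s) • z := by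
  obtain ⟨y, rfl⟩ := hφ.comp_left z
  obtain ⟨s, hs⟩ := IsLocalization.exist_integer_multiples_of_finite M y
  choose t ht using hs
  refine ⟨s, (IsLocalization.map_units S s).map φ, t, funext fun j => ?_⟩
  simp [ht, Algebra.smul_def]

lemma IsPresentation.rowCondition_of_isApproxGorenstein {T : Type u} [CommRing T] {f : T}
    {I : Ideal T} {n m : ℕ} {fs : Fin n → T} {X : Matrix (Fin (n + 1)) (Fin m) T}
    (hX : IsPresentation (Fin.cons f fs : Fin (n + 1) → T) X) (hfs : ∀ i, fs i ∈ I)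
    (hA : IsApproxGorenstein (T ⧸ I)) (h : ∀ J : Ideal T, I ≤ J → (I * J).colon {f} ≤ J) :
    RowCondition I X := by
  have := hA.1
  refine rowCondition_iff_mem_span.2 (mem_span_range_of_localization_maximal fun q _ =>
    (hA.2 q).mem_span_range fun B _ _ φ hφ => ?_)
  let ρ : T →+* B := (φ.comp (algebraMap (T ⧸ I) (Localization.AtPrime q))).comp
    (Ideal.Quotient.mk I)
  have I_le_ker : I ≤ RingHom.ker ρ := fun t ht => by
    simp [ρ, RingHom.mem_ker, Ideal.Quotient.eq_zero_iff_mem.2 ht]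
  refine hX.map_row_mem_span hfs ρ (fun z => ?_) (h _ I_le_ker)
  obtain ⟨s, hs, t, ht⟩ := exists_isUnit_smul_eq_comp q.primeCompl hφ z
  obtain ⟨s, rfl⟩ := Ideal.Quotient.mk_surjective s
  obtain ⟨t, rfl⟩ := Ideal.Quotient.mk_surjective.comp_left t
  exact ⟨s, hs, t, ht⟩

end ApproximatelyGorenstein

end WeakLifting

open WeakLifting in
theorem lemma4p2_general {T : Type u} [CommRing T] [IsNoetherianRing T]
    {f : T} (hf : f ∈ nonZeroDivisors T) {I : Ideal T} (hfI : f ∈ I) {n : ℕ} {fs : Fin n → T}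
    (hI : Ideal.span (Set.range (Fin.cons f fs : Fin (n + 1) → T)) = I) :
    List.TFAE [
      QuotientWeaklyLiftable I f hfI,
      Splits (mapToModF I f hfI),
      Splits (mapToCotangent I f hfI),
      ∀ (m : ℕ) (X : Matrix (Fin (n + 1)) (Fin m) T),
        IsPresentation (Fin.cons f fs : Fin (n + 1) → T) X → RowCondition I X,
      ∃ (m : ℕ) (X : Matrix (Fin (n + 1)) (Fin m) T),
        IsPresentation (Fin.cons f fs : Fin (n + 1) → T) X ∧ RowCondition I X] ∧
    (QuotientWeaklyLiftable I f hfI → ∀ J : Ideal T, (I * J).colon {f} ≤ J ⊔ I) ∧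
    List.TFAE [
      ∀ J : Ideal T, (I * J).colon {f} ≤ J ⊔ I,
      ∀ J : Ideal T, I ≤ J → (I * J).colon {f} ≤ J,
      ∀ J : Ideal T, InfIrred J → I ≤ J → (I * J).colon {f} ≤ J] ∧
    (IsApproxGorenstein (T ⧸ I) →
      (QuotientWeaklyLiftable I f hfI ↔ ∀ J : Ideal T, (I * J).colon {f} ≤ J ⊔ I)) := by
  have lifting_iff := quotientWeaklyLiftable_iff hf hfI (IsNoetherian.noetherian I)
  obtain ⟨m, X, hX⟩ := IsPresentation.exists_of_isNoetherianRing (Fin.cons f fs : Fin (n + 1) → T)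
  have colon_le (h : QuotientWeaklyLiftable I f hfI) (J : Ideal T) : (I * J).colon {f} ≤ J ⊔ I := by
    obtain ⟨φ, hφ⟩ := lifting_iff.1 h
    exact colon_le_sup_of_linearMap hφ J
  refine ⟨?_, colon_le, ?_, fun hA => ⟨colon_le, fun h => ?_⟩⟩
  · tfae_have 1 ↔ 2 := lifting_iff.trans (splits_mapToModF_iff hfI).symm
    tfae_have 1 ↔ 3 := lifting_iff.trans (splits_mapToCotangent_iff hfI).symm
    tfae_have 1 → 4 := fun h _ _ hX => (hX.rowCondition_iff hI hfI).2 (lifting_iff.1 h)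
    tfae_have 4 → 5 := fun h => ⟨m, X, hX, h m X hX⟩
    tfae_have 5 → 1 := fun ⟨_, _, hX, h⟩ => lifting_iff.2 ((hX.rowCondition_iff hI hfI).1 h)
    tfae_finish
  · tfae_have 1 ↔ 2 := forall_colon_le_sup_iff I f
    tfae_have 2 ↔ 3 := forall_colon_le_iff_forall_infIrred I f
    tfae_finish
  · have hfs (i : Fin n) : fs i ∈ I := hI ▸ Ideal.subset_span ⟨i.succ, Fin.cons_succ _ _ _⟩
    exact lifting_iff.2 ((hX.rowCondition_iff hI hfI).1
      (hX.rowCondition_of_isApproxGorenstein hfs hA ((forall_colon_le_sup_iff I f).1 h)))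

theorem lemma4p2 {T : Type u} [CommRing T] [IsNoetherianRing T]
    (f : T) (hf : f ∈ nonZeroDivisors T) (I : Ideal T) (hfI : f ∈ I)
    (n : ℕ) (fs : Fin n → T)
    (hI : Ideal.span (Set.range (Fin.cons f fs : Fin (n + 1) → T)) = I) :
    -- conditions (1), (2), (3), (4) (for every presentation, and for some presentation)
    List.TFAE [
      WeakLifting.QuotientWeaklyLiftable I f hfI,
      WeakLifting.Splits (WeakLifting.mapToModF I f hfI),
      WeakLifting.Splits (WeakLifting.mapToCotangent I f hfI),
      ∀ (m : ℕ) (X : Matrix (Fin (n + 1)) (Fin m) T),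
        WeakLifting.IsPresentation (Fin.cons f fs : Fin (n + 1) → T) X →
          WeakLifting.RowCondition I X,
      ∃ (m : ℕ) (X : Matrix (Fin (n + 1)) (Fin m) T),
        WeakLifting.IsPresentation (Fin.cons f fs : Fin (n + 1) → T) X ∧
          WeakLifting.RowCondition I X] ∧
    -- they imply (5)
    (WeakLifting.QuotientWeaklyLiftable I f hfI →
      ∀ J : Ideal T, (I * J).colon {f} ≤ J ⊔ I) ∧
    -- (5) and (6) are equivalent
    ((∀ J : Ideal T, (I * J).colon {f} ≤ J ⊔ I) ↔
      ∀ J : Ideal T, I ≤ J → (I * J).colon {f} ≤ J) ∧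
    -- in the local case they are also equivalent to (7)
    (IsLocalRing T →
      ((∀ J : Ideal T, I ≤ J → (I * J).colon {f} ≤ J) ↔
        ∀ J : Ideal T, InfIrred J → I ≤ J → (I * J).colon {f} ≤ J)) ∧
    -- all the conditions are equivalent if `T/I` is approximately Gorenstein
    (WeakLifting.IsApproxGorenstein (T ⧸ I) →
      (WeakLifting.QuotientWeaklyLiftable I f hfI ↔
        ∀ J : Ideal T, (I * J).colon {f} ≤ J ⊔ I)) := by
  obtain ⟨tfae, colon_le, colon_tfae, gorenstein⟩ := lemma4p2_general hf hfI hI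
  exact ⟨tfae, colon_le, colon_tfae.out 0 1, fun _ => colon_tfae.out 1 2, gorenstein⟩
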